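/- Let $H$ be a complex Hilbert space and let $M\subset B(H)$ be a von Neumann algebra, i.e. a $*$-subalgebra of $B(H)$ that equals its double commutant $M''$. Let $M_*$ be its predual, i.e. the Banach space of normal functionals on $M$ (the norm closure in $M^*$ of the linear span of the vector functionals $x\mapsto\langle x\xi,\eta\rangle$, $\xi,\eta\in H$), whose dual is $M$. For a Banach space $X$, a linear subspace $D\subset X^*$ is called $1$-norming if $\|x\|=\sup\{|f(x)|: f\in D,\ \|f\|\le 1\}$ for all $x\in X$, and it is called a $\Sigma$-subspace if there is a set $S\subset X$ with dense linear span such that $D=\{f\in X^*: \{m\in S: f(m)\neq 0\}\text{ is countable}\}$. The space $X$ is $1$-Plichko if $X^*$ has a $1$-norming $\Sigma$-subspace; weakly Lindelöf determined (WLD) if $X^*$ is a $\Sigma$-subspace of itself; weakly compactly generated (WCG) if $X$ has a weakly compact subset with dense linear span. The algebra $M$ is $\sigma$-finite if every family of pairwise orthogonal nonzero projections in $M$ is countable. Then $M_*$ is $1$-Plichko. Moreover, $M_*$ is WLD if and only if $M$ is $\sigma$-finite, and in this case $M_*$ is even WCG. -/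

import Mathlib

section BanachSpaceNotions

variable (𝕜 : Type*) [RCLike 𝕜] (X : Type*) [NormedAddCommGroup X] [NormedSpace 𝕜 X]

variable {𝕜 X} in
/-- A subset of a normed space is linearly dense if its linear span is norm dense. -/
def IsLinearlyDense (S : Set X) : Prop :=
  Dense (Submodule.span 𝕜 S : Set X)

variable {𝕜 X} in
/-- A linear subspace `D` of the dual is `1`-norming if
`‖x‖ = sup {|f x| : f ∈ D, ‖f‖ ≤ 1}` for every `x`. -/
def IsOneNorming (D : Submodule 𝕜 (StrongDual 𝕜 X)) : Prop :=
  ∀ x : X, IsLUB {r : ℝ | ∃ f ∈ D, ‖f‖ ≤ 1 ∧ r = ‖f x‖} ‖x‖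

variable {𝕜 X} in
/-- `D` is a `Σ`-subspace of the dual of `X`: there is a linearly dense set `S ⊆ X` such that `D`
consists exactly of those functionals that are nonzero at only countably many points of `S`. -/
def IsSigmaSubspace (D : Submodule 𝕜 (StrongDual 𝕜 X)) : Prop :=
  ∃ S : Set X, IsLinearlyDense (𝕜 := 𝕜) S ∧
    ∀ f : StrongDual 𝕜 X, f ∈ D ↔ {m ∈ S | f m ≠ 0}.Countable

/-- `X` is `1`-Plichko: its dual has a `1`-norming `Σ`-subspace. -/
def IsOnePlichko : Prop :=
  ∃ D : Submodule 𝕜 (StrongDual 𝕜 X), IsOneNorming D ∧ IsSigmaSubspace D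

/-- `X` is weakly Lindelöf determined: the whole dual is a `Σ`-subspace of itself. -/
def IsWLD : Prop :=
  IsSigmaSubspace (⊤ : Submodule 𝕜 (StrongDual 𝕜 X))

/-- `X` is weakly compactly generated: some weakly compact subset is linearly dense. -/
def IsWCG : Prop :=
  ∃ K : Set X, IsCompact (toWeakSpace 𝕜 X '' K) ∧ IsLinearlyDense (𝕜 := 𝕜) K

end BanachSpaceNotions

namespace VonNeumannAlgebra

open scoped InnerProductSpace

variable {H : Type*} [NormedAddCommGroup H] [InnerProductSpace ℂ H] [CompleteSpace H]

/-- The vector functional `x ↦ ⟨x ξ, η⟩` on a von Neumann algebra (Mathlib's inner product is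
linear in its second argument). -/
noncomputable def vectorFunctional (M : VonNeumannAlgebra H) (ξ η : H) :
    StrongDual ℂ M.toStarSubalgebra :=
  ((innerSL ℂ η).comp (ContinuousLinearMap.apply ℂ H ξ)).comp
    (Subalgebra.toSubmodule M.toSubalgebra).subtypeL

/-- The norm closure, in the Banach space dual of `M`, of the linear span of the vector functionals.
These are the normal (that is, ultraweakly continuous) functionals on `M`. -/
noncomputable def normalFunctionals (M : VonNeumannAlgebra H) :
    Submodule ℂ (StrongDual ℂ M.toStarSubalgebra) :=
  (Submodule.span ℂ {φ | ∃ ξ η : H, φ = M.vectorFunctional ξ η}).topologicalClosure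

/-- The predual of `M`, realised in the usual way as the Banach space of all normal functionals
on `M`, with the norm of the dual of `M`. See `exists_equiv_dual_predual` for the fact that its
dual is `M`. -/
def Predual (M : VonNeumannAlgebra H) : Type _ := M.normalFunctionals

noncomputable instance Predual.instNormedAddCommGroup (M : VonNeumannAlgebra H) :
    NormedAddCommGroup M.Predual :=
  inferInstanceAs (NormedAddCommGroup M.normalFunctionals)

noncomputable instance Predual.instNormedSpace (M : VonNeumannAlgebra H) :
    NormedSpace ℂ M.Predual :=
  inferInstanceAs (NormedSpace ℂ M.normalFunctionals)

instance Predual.instCompleteSpace (M : VonNeumannAlgebra H) : CompleteSpace M.Predual :=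
  (Submodule.isClosed_topologicalClosure
    (Submodule.span ℂ {φ | ∃ ξ η : H, φ = M.vectorFunctional ξ η})).completeSpace_coe

/-- The inclusion of the predual into the dual of `M`. -/
noncomputable def Predual.toDual (M : VonNeumannAlgebra H) :
    M.Predual →ₗᵢ[ℂ] StrongDual ℂ M.toStarSubalgebra where
  toFun φ := φ.1
  map_add' _ _ := rfl
  map_smul' _ _ := rfl
  norm_map' _ := rfl

/-- `M` is `σ`-finite: every set of pairwise orthogonal projections of `M` is countable. -/
def IsSigmaFinite (M : VonNeumannAlgebra H) : Prop :=
  ∀ P : Set (H →L[ℂ] H), (∀ p ∈ P, p ∈ M ∧ IsStarProjection p) →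
    P.Pairwise (fun p q => p * q = 0) → P.Countable

theorem vectorFunctional_apply (M : VonNeumannAlgebra H) (ξ η : H) (x : M.toStarSubalgebra) :
    M.vectorFunctional ξ η x = ⟪η, (x : H →L[ℂ] H) ξ⟫_ℂ := rfl

theorem norm_vectorFunctional_le (M : VonNeumannAlgebra H) (ξ η : H) :
    ‖M.vectorFunctional ξ η‖ ≤ ‖ξ‖ * ‖η‖ := by
  refine ContinuousLinearMap.opNorm_le_bound _ (by positivity) fun x => ?_
  rw [vectorFunctional_apply]
  calc _ ≤ ‖η‖ * ‖(x : H →L[ℂ] H) ξ‖ := norm_inner_le_norm _ _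
    _ ≤ ‖η‖ * (‖(x : H →L[ℂ] H)‖ * ‖ξ‖) := by
        gcongr; exact ContinuousLinearMap.le_opNorm _ _
    _ = ‖ξ‖ * ‖η‖ * ‖x‖ := by
        rw [show ‖x‖ = ‖(x : H →L[ℂ] H)‖ from rfl]; ring

theorem vectorFunctional_mem (M : VonNeumannAlgebra H) (ξ η : H) :
    M.vectorFunctional ξ η ∈ M.normalFunctionals :=
  Submodule.le_topologicalClosure _ (Submodule.subset_span ⟨ξ, η, rfl⟩)

/-- The vector functional `x ↦ ⟨x ξ, η⟩` as an element of the predual. -/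
noncomputable def Predual.vec (M : VonNeumannAlgebra H) (ξ η : H) : M.Predual :=
  ⟨M.vectorFunctional ξ η, M.vectorFunctional_mem ξ η⟩

theorem Predual.toDual_vec (M : VonNeumannAlgebra H) (ξ η : H) (x : M.toStarSubalgebra) :
    Predual.toDual M (Predual.vec M ξ η) x = ⟪η, (x : H →L[ℂ] H) ξ⟫_ℂ := rfl

theorem Predual.norm_vec_le (M : VonNeumannAlgebra H) (ξ η : H) :
    ‖Predual.vec M ξ η‖ ≤ ‖ξ‖ * ‖η‖ :=
  M.norm_vectorFunctional_le ξ η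

theorem Predual.ext (M : VonNeumannAlgebra H) {φ ψ : M.Predual}
    (h : ∀ x, Predual.toDual M φ x = Predual.toDual M ψ x) : φ = ψ :=
  (Predual.toDual M).injective (ContinuousLinearMap.ext h)

theorem Predual.dense_span_vec (M : VonNeumannAlgebra H) :
    Dense (Submodule.span ℂ {φ | ∃ ξ η : H, φ = Predual.vec M ξ η} : Set M.Predual) := by
  intro ψ
  have h1 : Predual.toDual M ψ ∈ closure ((Predual.toDual M) ''
      (Submodule.span ℂ {φ | ∃ ξ η : H, φ = Predual.vec M ξ η} : Set M.Predual)) := by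
    refine closure_mono ?_ (show ψ.1 ∈ closure _ from ψ.2)
    intro χ hχ
    have hmap : Submodule.span ℂ {φ | ∃ ξ η : H, φ = M.vectorFunctional ξ η} ≤
        (Submodule.span ℂ {φ | ∃ ξ η : H, φ = Predual.vec M ξ η}).map
          (Predual.toDual M).toLinearMap := by
      rw [Submodule.span_le]
      rintro _ ⟨ξ, η, rfl⟩
      exact ⟨Predual.vec M ξ η, Submodule.subset_span ⟨ξ, η, rfl⟩, rfl⟩
    exact hmap hχ
  exact ((Predual.toDual M).isometry.isUniformInducing.isInducing.closure_eq_preimage_closure_image _) ▸ h1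

/-- Evaluation identifies `M` isometrically with the Banach space dual of `M.Predual`. -/
theorem exists_equiv_dual_predual (M : VonNeumannAlgebra H) :
    ∃ e : M.toStarSubalgebra ≃ₗᵢ[ℂ] StrongDual ℂ M.Predual,
      ∀ (x : M.toStarSubalgebra) (φ : M.Predual), e x φ = Predual.toDual M φ x := by
  let e₀ : M.toStarSubalgebra →ₗ[ℂ] StrongDual ℂ M.Predual :=
    { toFun := fun x => (NormedSpace.inclusionInDoubleDual ℂ M.toStarSubalgebra x).comp
        (Predual.toDual M).toContinuousLinearMap
      map_add' := fun x y => by ext φ; simp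
      map_smul' := fun c x => by ext φ; simp }
  have he₀ : ∀ (x : M.toStarSubalgebra) (φ : M.Predual),
      e₀ x φ = Predual.toDual M φ x := fun _ _ => rfl
  have hnorm : ∀ x, ‖e₀ x‖ = ‖x‖ := by
    intro x
    apply le_antisymm
    · refine ContinuousLinearMap.opNorm_le_bound _ (norm_nonneg _) fun φ => ?_
      rw [he₀, mul_comm, ← (Predual.toDual M).norm_map φ]
      exact ContinuousLinearMap.le_opNorm _ _
    · refine ContinuousLinearMap.opNorm_le_bound (x : H →L[ℂ] H) (norm_nonneg _) fun ξ => ?_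
      set ζ := (x : H →L[ℂ] H) ξ with hζ
      by_cases h0 : ‖ζ‖ = 0
      · rw [h0]; positivity
      have h1 : ‖ζ‖ * ‖ζ‖ ≤ ‖e₀ x‖ * ‖ξ‖ * ‖ζ‖ := by
        have h2 := (e₀ x).le_opNorm (Predual.vec M ξ ζ)
        rw [he₀, Predual.toDual_vec, ← hζ, inner_self_eq_norm_sq_to_K, norm_pow, RCLike.norm_ofReal,
          abs_norm, sq] at h2
        refine h2.trans ?_
        rw [mul_assoc]
        exact mul_le_mul_of_nonneg_left (Predual.norm_vec_le M ξ ζ) (norm_nonneg _)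
      exact le_of_mul_le_mul_right h1 (lt_of_le_of_ne (norm_nonneg _) (Ne.symm h0))
  have hsurj : Function.Surjective e₀ := by
    intro f
    let B : H →L⋆[ℂ] H →L[ℂ] ℂ := LinearMap.mkContinuous₂
      (LinearMap.mk₂'ₛₗ (starRingEnd ℂ) (RingHom.id ℂ) (fun η ξ => f (Predual.vec M ξ η))
        (fun a b c => by
          rw [← map_add]; congr 1; refine Predual.ext M fun y => ?_
          simp [Predual.toDual_vec])
        (fun c a b => by
          rw [← map_smul]; congr 1; refine Predual.ext M fun y => ?_
          simp [Predual.toDual_vec, mul_comm])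
        (fun a b c => by
          rw [← map_add]; congr 1; refine Predual.ext M fun y => ?_
          simp [Predual.toDual_vec])
        (fun c a b => by
          rw [RingHom.id_apply, ← map_smul]; congr 1; refine Predual.ext M fun y => ?_
          simp [Predual.toDual_vec]))
      ‖f‖ (fun η ξ => by
        refine (f.le_opNorm (Predual.vec M ξ η)).trans ?_
        rw [mul_assoc, mul_comm ‖η‖]
        exact mul_le_mul_of_nonneg_left (Predual.norm_vec_le M ξ η) (norm_nonneg _))
    let T : H →L[ℂ] H := ContinuousLinearMap.adjoint
      (InnerProductSpace.continuousLinearMapOfBilin B)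
    have hT : ∀ η ξ, ⟪η, T ξ⟫_ℂ = f (Predual.vec M ξ η) := fun η ξ => by
      rw [ContinuousLinearMap.adjoint_inner_right]
      exact InnerProductSpace.continuousLinearMapOfBilin_apply B η ξ
    have hmem : T ∈ M := by
      rw [← SetLike.mem_coe, ← M.centralizer_centralizer, Set.mem_centralizer_iff]
      intro a ha
      rw [Set.mem_centralizer_iff] at ha
      ext ξ
      refine ext_inner_left ℂ fun η => ?_
      change ⟪η, a (T ξ)⟫_ℂ = ⟪η, T (a ξ)⟫_ℂ
      rw [hT, ← ContinuousLinearMap.adjoint_inner_left, hT]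
      congr 1
      refine Predual.ext M fun y => ?_
      have h : (y : H →L[ℂ] H) (a ξ) = a ((y : H →L[ℂ] H) ξ) :=
        congrArg (fun S : H →L[ℂ] H => S ξ) (ha y y.2)
      rw [Predual.toDual_vec, Predual.toDual_vec, ContinuousLinearMap.adjoint_inner_left, h]
    refine ⟨⟨T, hmem⟩, ContinuousLinearMap.ext_on (Predual.dense_span_vec M) ?_⟩
    rintro _ ⟨ξ, η, rfl⟩
    exact hT η ξ
  exact ⟨LinearIsometryEquiv.ofSurjective ⟨e₀, hnorm⟩ hsurj, he₀⟩

end VonNeumannAlgebra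

/-!
The dual of `M_*` is `M`, so the statement is about finding, in `M_*`, a linearly dense set on which
many elements of `M` have countable support. By Zorn's lemma there is a set `Ξ` of nonzero vectors
whose cyclic subspaces `[M' ξ]` under the commutant are pairwise orthogonal and span `H`
(`exists_isOrthogonalGenerating`). With an orthonormal basis `(e)` of `H`, let `S` be the set of
vector functionals `x ↦ ⟪ξ, x e⟫ = ⟪x* ξ, e⟫` with `ξ ∈ Ξ`. An `x ∈ M` that vanishes on `S` satisfies
`x* ξ = 0` for all `ξ ∈ Ξ`, hence `x = 0`, as `x*` commutes with `M'`; so `S` is linearly dense. By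
Bessel's inequality, `x` has countable support on `S` as soon as `x* ξ ≠ 0` for only countably many
`ξ ∈ Ξ`.

* `1`-Plichko (`isOnePlichko`): let `P F ∈ M` be the projection onto the sum of `[M' ξ]` over a
  finite `F ⊆ Ξ`. Then `P F * x` has countable support on `S` and norm at most `‖x‖`, and
  `φ (P F * x) → φ x` for every normal `φ`. So the functionals with countable support are
  `1`-norming.
* If `M` is `σ`-finite, then `Ξ` is countable because the projections onto the `[M' ξ]` are
  orthogonal. Hence every `x ∈ M` has countable support on `S` (`isWLD`). With suitable weights, the
  values of each `x` on `S` become square summable, so that `S ∪ {0}` becomes weakly compact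
  (`isWCG`).
* If `M_*` is WLD, take an orthogonal family of nonzero projections `p i`. As functionals on `M_*`
  they satisfy `∑ |φ (p i)| ≤ ‖φ‖`, which makes all their `0`-`1` sums functionals on `M_*`. If there
  were uncountably many, one of these sums would have uncountable support
  (`IsWLD.countable_of_sum_norm_le`).
-/

/-! ### Weak compactness and countable supports in Banach spaces -/

section Banach

open Filter Topology

variable {𝕜 : Type*} [RCLike 𝕜] {X : Type*} [NormedAddCommGroup X] [NormedSpace 𝕜 X]

/-- A Hahn–Banach criterion for linear density. -/
theorem isLinearlyDense_of_forall_dual {S : Set X}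
    (h : ∀ f : StrongDual 𝕜 X, (∀ m ∈ S, f m = 0) → f = 0) :
    IsLinearlyDense (𝕜 := 𝕜) S := by
  set N := (Submodule.span 𝕜 S).topologicalClosure with hN
  have : IsClosed (N : Set X) := Submodule.isClosed_topologicalClosure _
  rw [IsLinearlyDense, Submodule.dense_iff_topologicalClosure_eq_top, ← hN, Submodule.eq_top_iff']
  intro x
  rw [← Submodule.Quotient.mk_eq_zero]
  refine SeparatingDual.eq_zero_of_forall_dual_eq_zero (R := 𝕜) fun f => ?_
  have hf : f.comp N.mkQL = 0 := h _ fun m hm => by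
    have : N.mkQ m = 0 := (Submodule.Quotient.mk_eq_zero N).2
      (Submodule.le_topologicalClosure _ (Submodule.subset_span hm))
    change f (N.mkQ m) = 0
    rw [this, map_zero]
  exact congrArg (fun g : StrongDual 𝕜 X => g x) hf

theorem IsLinearlyDense.exists_apply_ne_zero {S : Set X} (hS : IsLinearlyDense (𝕜 := 𝕜) S)
    {f : StrongDual 𝕜 X} (hf : f ≠ 0) : ∃ m ∈ S, f m ≠ 0 := by
  by_contra! h
  exact hf (ContinuousLinearMap.ext_on hS fun m hm => by simpa using h m hm)

/-- Bounded nets of functionals converge pointwise as soon as they do so on a linearly dense set. -/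
theorem IsLinearlyDense.tendsto_apply {S : Set X} (hS : IsLinearlyDense (𝕜 := 𝕜) S) {ι : Type*}
    {l : Filter ι} (f : ι → StrongDual 𝕜 X) (g : StrongDual 𝕜 X) (C : NNReal)
    (hf : ∀ i, ‖f i‖₊ ≤ C) (h : ∀ m ∈ S, Tendsto (fun i => f i m) l (𝓝 (g m))) (x : X) :
    Tendsto (fun i => f i x) l (𝓝 (g x)) := by
  have heq : Equicontinuous fun i => (f i : X → 𝕜) :=
    (LipschitzWith.uniformEquicontinuous (fun i => (f i : X → 𝕜)) C
      fun i => (f i).lipschitz.weaken (hf i)).equicontinuous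
  have hcl := heq.isClosed_setOfPred_tendsto (l := l) g.continuous
  refine (hcl.closure_subset_iff.2 ?_) (hS x)
  intro m hm
  induction hm using Submodule.span_induction with
  | mem m hm => exact h m hm
  | zero => simpa using tendsto_const_nhds
  | add a b _ _ ha hb =>
    change Tendsto (fun i => f i (a + b)) l (𝓝 (g (a + b)))
    simp only [map_add]
    exact Tendsto.add ha hb
  | smul c a _ ha =>
    change Tendsto (fun i => f i (c • a)) l (𝓝 (g (c • a)))
    simp only [map_smul]
    exact Tendsto.const_smul ha c

/-- A linearly dense family tending weakly to `0` along the cofinite filter generates the space: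
together with `0` it is weakly compact. -/
theorem isWCG_of_tendsto_cofinite {ι : Type*} (u : ι → X)
    (hu : IsLinearlyDense (𝕜 := 𝕜) (Set.range u))
    (h : ∀ f : StrongDual 𝕜 X, Tendsto (fun i => f (u i)) cofinite (𝓝 0)) : IsWCG 𝕜 X := by
  refine ⟨insert 0 (Set.range u), ?_, ?_⟩
  · have ht : Tendsto (fun i => toWeakSpace 𝕜 X (u i)) cofinite (𝓝 (toWeakSpace 𝕜 X 0)) := by
      refine (WeakBilin.tendsto_iff_forall_eval_tendsto (topDualPairing 𝕜 X).flip ?_).2 fun f => ?_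
      · intro x y hxy
        exact (SeparatingDual.eq_iff_forall_dual_eq (R := 𝕜)).2 fun g => LinearMap.congr_fun hxy g
      · have h0 := h f
        rw [← map_zero f] at h0
        exact h0
    rw [Set.image_insert_eq, ← Set.range_comp]
    exact ht.isCompact_insert_range_of_cofinite
  · exact hu.mono (Submodule.span_mono (Set.subset_insert _ _))

/-- The `Σ`-subspace attached to a set `S`: all functionals with countable support on `S`. -/
def countableSupport (𝕜 : Type*) [RCLike 𝕜] {X : Type*} [NormedAddCommGroup X] [NormedSpace 𝕜 X]
    (S : Set X) : Submodule 𝕜 (StrongDual 𝕜 X) where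
  carrier := {f | {m ∈ S | f m ≠ 0}.Countable}
  zero_mem' := by simp
  add_mem' {f g} hf hg := by
    refine (Set.Countable.union hf hg).mono ?_
    rintro m ⟨hm, hne⟩
    by_cases h : f m = 0
    · exact Or.inr ⟨hm, fun h' => hne (by simp [h, h'])⟩
    · exact Or.inl ⟨hm, h⟩
  smul_mem' c f hf := by
    refine Set.Countable.mono ?_ hf
    rintro m ⟨hm, hne⟩
    exact ⟨hm, fun h' => hne (by simp [h'])⟩

theorem mem_countableSupport {S : Set X} {f : StrongDual 𝕜 X} :
    f ∈ countableSupport 𝕜 S ↔ {m ∈ S | f m ≠ 0}.Countable := Iff.rfl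

/-- If the functionals `g i` are nonzero and satisfy `∑ |g i x| ≤ ‖x‖`, their `0`-`1` sums over
all subsets of the index set are functionals as well. For uncountably many `g i`, one of these sums
would have uncountable support on a set `S` witnessing that the space is weakly Lindelöf determined:
sum over a maximal `J` such that no `m ∈ S` is in the support of two functionals of `J`. -/
theorem IsWLD.countable_of_sum_norm_le (hX : IsWLD 𝕜 X) {ι : Type*} (g : ι → StrongDual 𝕜 X)
    (hg : ∀ i, g i ≠ 0) (hsum : ∀ (x : X) (F : Finset ι), ∑ i ∈ F, ‖g i x‖ ≤ ‖x‖) :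
    Countable ι := by
  obtain ⟨S, hS, hD⟩ := hX
  replace hD : ∀ f : StrongDual 𝕜 X, {m ∈ S | f m ≠ 0}.Countable :=
    fun f => (hD f).1 Submodule.mem_top
  have hnorm : ∀ x : X, Summable fun i => ‖g i x‖ := fun x =>
    summable_of_sum_le (fun i => norm_nonneg _) (hsum x)
  have hsupp : ∀ x : X, {i | g i x ≠ 0}.Countable := fun x => (hnorm x).of_norm.countable_support
  -- Every set of indices has a sum, as a functional on `X`.
  have hf : ∀ J : Set ι, ∃ f : StrongDual 𝕜 X, ∀ x, f x = ∑' j : J, g j x := by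
    intro J
    have hJ : ∀ x, Summable fun j : J => g j x := fun x => (hnorm x).of_norm.subtype J
    refine ⟨LinearMap.mkContinuous
      { toFun := fun x => ∑' j : J, g j x
        map_add' := fun x y => by
          simp only [map_add]; exact (hJ x).tsum_add (hJ y)
        map_smul' := fun c x => by
          simp only [map_smul, RingHom.id_apply]; exact (hJ x).tsum_const_smul c } 1
      fun x => ?_, fun x => rfl⟩
    have h1 : Summable fun j : J => ‖g j x‖ := (hnorm x).subtype J
    calc ‖∑' j : J, g j x‖ ≤ ∑' j : J, ‖g j x‖ := norm_tsum_le_tsum_norm h1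
      _ ≤ ∑' i, ‖g i x‖ := Summable.tsum_subtype_le _ J (fun i => norm_nonneg _) (hnorm x)
      _ ≤ ‖x‖ := Real.tsum_le_of_sum_le (fun i => norm_nonneg _) (hsum x)
      _ = 1 * ‖x‖ := (one_mul _).symm
  obtain ⟨J, hJ⟩ := zorn_subset
    {J : Set ι | ∀ m ∈ S, ∀ i ∈ J, ∀ j ∈ J, g i m ≠ 0 → g j m ≠ 0 → i = j} (by
      intro c hc hchain
      refine ⟨⋃₀ c, ?_, fun s hs => Set.subset_sUnion_of_mem hs⟩
      rintro m hm i ⟨s, hs, hi⟩ j ⟨t, ht, hj⟩ him hjm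
      rcases hchain.total hs ht with h | h
      · exact hc ht m hm i (h hi) j hj him hjm
      · exact hc hs m hm i hi j (h hj) him hjm)
  have hJS := hJ.prop
  -- `J` is countable, as the sum over `J` has countable support on `S`.
  have hJc : J.Countable := by
    obtain ⟨f, hf⟩ := hf J
    choose m hmS hm using fun j : J => hS.exists_apply_ne_zero (hg j)
    have hfm : ∀ j : J, f (m j) ≠ 0 := fun j => by
      rw [hf, tsum_eq_single j]
      · exact hm j
      · intro k hk
        by_contra hne
        exact hk (Subtype.ext (hJS _ (hmS j) _ k.2 _ j.2 hne (hm j)))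
    have hinj : Function.Injective m := fun j k hjk =>
      Subtype.ext (hJS _ (hmS j) _ j.2 _ k.2 (hm j) (hjk ▸ hm k))
    have := (hD f).to_subtype
    have hc : Countable J := Function.Injective.countable
      (f := fun j : J => (⟨m j, hmS j, hfm j⟩ : {m ∈ S | f m ≠ 0}))
      fun j k hjk => hinj (congrArg Subtype.val hjk)
    exact hc
  -- By maximality every index is linked to `J` through some `m ∈ S`.
  have hcover : (Set.univ : Set ι) ⊆
      ⋃ j ∈ J, ⋃ m ∈ {m ∈ S | g j m ≠ 0}, {i | g i m ≠ 0} := by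
    intro i _
    simp only [Set.mem_iUnion]
    by_cases hi : i ∈ J
    · obtain ⟨m, hmS, hm⟩ := hS.exists_apply_ne_zero (hg i)
      exact ⟨i, hi, m, ⟨hmS, hm⟩, hm⟩
    by_contra! hcon
    refine hi (hJ.le_of_ge (y := insert i J) ?_ (Set.subset_insert _ _) (Set.mem_insert _ _))
    rintro m hm a (rfl | ha) b (rfl | hb) ham hbm
    · rfl
    · exact absurd ham (hcon b hb m ⟨hm, hbm⟩)
    · exact absurd hbm (hcon a ha m ⟨hm, ham⟩)
    · exact hJS m hm a ha b hb ham hbm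
  exact Set.countable_univ_iff.1 <|
    (hJc.biUnion fun j _ => (hD (g j)).biUnion fun m _ => hsupp m).mono hcover

end Banach

namespace VonNeumannAlgebra

open scoped InnerProductSpace
open Filter Topology

variable {H : Type*} [NormedAddCommGroup H] [InnerProductSpace ℂ H] [CompleteSpace H]

/-! ### Orthogonal projections are summed absolutely by functionals -/

theorem norm_sum_sq_of_pairwise_inner_eq_zero {E : Type*} [NormedAddCommGroup E]
    [InnerProductSpace ℂ E] {ι : Type*} (F : Finset ι) (v : ι → E)
    (h : ∀ i ∈ F, ∀ j ∈ F, i ≠ j → ⟪v i, v j⟫_ℂ = 0) :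
    ‖∑ i ∈ F, v i‖ ^ 2 = ∑ i ∈ F, ‖v i‖ ^ 2 := by
  classical
  induction F using Finset.induction_on with
  | empty => simp
  | insert a F ha ih =>
    have h0 : ⟪v a, ∑ i ∈ F, v i⟫_ℂ = 0 := by
      rw [inner_sum]
      refine Finset.sum_eq_zero fun i hi => h _ (Finset.mem_insert_self _ _) _
        (Finset.mem_insert_of_mem hi) ?_
      rintro rfl
      exact ha hi
    rw [Finset.sum_insert ha, Finset.sum_insert ha, norm_add_sq (𝕜 := ℂ), h0,
      ih fun i hi j hj => h i (Finset.mem_insert_of_mem hi) j (Finset.mem_insert_of_mem hj)]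
    simp

theorem norm_sum_smul_projection_le {ι : Type*} (F : Finset ι) (p : ι → H →L[ℂ] H)
    (hp : ∀ i, IsStarProjection (p i)) (hpq : ∀ i j, i ≠ j → p i * p j = 0) (c : ι → ℂ)
    (hc : ∀ i, ‖c i‖ ≤ 1) : ‖∑ i ∈ F, c i • p i‖ ≤ 1 := by
  have hinner : ∀ i x y, ⟪p i x, y⟫_ℂ = ⟪x, p i y⟫_ℂ := fun i x y =>
    (hp i).isSelfAdjoint.isSymmetric x y
  have hort : ∀ i j, i ≠ j → ∀ x, ⟪p i x, p j x⟫_ℂ = 0 := fun i j hij x => by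
    rw [hinner, ← mul_apply_eq_comp, hpq i j hij]; simp
  refine ContinuousLinearMap.opNorm_le_bound _ zero_le_one fun x => ?_
  set s : ℝ := ∑ i ∈ F, ‖p i x‖ ^ 2 with hs
  have hs0 : 0 ≤ s := Finset.sum_nonneg fun i _ => by positivity
  have h1 : ‖∑ i ∈ F, p i x‖ ^ 2 = s :=
    norm_sum_sq_of_pairwise_inner_eq_zero F _ fun i _ j _ hij => hort i j hij x
  have h2 : ‖(∑ i ∈ F, c i • p i) x‖ ^ 2 ≤ s := by
    rw [sum_apply, norm_sum_sq_of_pairwise_inner_eq_zero F]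
    · refine Finset.sum_le_sum fun i _ => ?_
      rw [smul_apply, norm_smul]
      gcongr
      exact mul_le_of_le_one_left (norm_nonneg _) (hc i)
    · intro i _ j _ hij
      rw [smul_apply, smul_apply, inner_smul_left, inner_smul_right, hort i j hij x, mul_zero,
        mul_zero]
  -- Bessel's inequality, from `∑ ‖p i x‖ ^ 2 = ⟪x, ∑ p i x⟫`.
  have h3 : s ≤ ‖x‖ * ‖∑ i ∈ F, p i x‖ := by
    have h4 : ⟪x, ∑ i ∈ F, p i x⟫_ℂ = (s : ℂ) := by
      rw [inner_sum, hs, Complex.ofReal_sum]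
      refine Finset.sum_congr rfl fun i _ => ?_
      have h5 : p i (p i x) = p i x := congrArg (fun T : H →L[ℂ] H => T x) (hp i).isIdempotentElem
      rw [← h5, ← hinner, inner_self_eq_norm_sq_to_K, h5]
      norm_cast
    have h5 := norm_inner_le_norm (𝕜 := ℂ) x (∑ i ∈ F, p i x)
    rwa [h4, Complex.norm_real, Real.norm_of_nonneg hs0] at h5
  have h6 : ‖∑ i ∈ F, p i x‖ ≤ ‖x‖ := by
    nlinarith [norm_nonneg x, norm_nonneg (∑ i ∈ F, p i x)]
  rw [one_mul]
  refine le_of_sq_le_sq ?_ (norm_nonneg x)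
  rw [← h1] at h2
  exact h2.trans (by gcongr)

theorem sum_norm_apply_projection_le (M : VonNeumannAlgebra H) {ι : Type*} (F : Finset ι)
    (p : ι → M.toStarSubalgebra) (hp : ∀ i, IsStarProjection (p i : H →L[ℂ] H))
    (hpq : ∀ i j, i ≠ j → (p i : H →L[ℂ] H) * p j = 0) (φ : StrongDual ℂ M.toStarSubalgebra) :
    ∑ i ∈ F, ‖φ (p i)‖ ≤ ‖φ‖ := by
  -- The coefficients `c i` are the phases that make `c i * φ (p i)` nonnegative.
  set c : ι → ℂ := fun i => starRingEnd ℂ (φ (p i)) / ‖φ (p i)‖ with hc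
  have hc1 : ∀ i, ‖c i‖ ≤ 1 := fun i => by
    simp only [hc, norm_div, RCLike.norm_conj, Complex.norm_real, norm_norm]
    exact div_self_le_one _
  have hφ : φ (∑ i ∈ F, c i • p i) = ((∑ i ∈ F, ‖φ (p i)‖ : ℝ) : ℂ) := by
    rw [map_sum, Complex.ofReal_sum]
    refine Finset.sum_congr rfl fun i _ => ?_
    rw [map_smul, smul_eq_mul, hc]
    by_cases h : φ (p i) = 0
    · simp [h]
    · have h' : (‖φ (p i)‖ : ℂ) ≠ 0 := by simpa using h
      rw [div_mul_eq_mul_div, div_eq_iff h', Complex.conj_mul', sq]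
  have hT : ‖∑ i ∈ F, c i • p i‖ ≤ 1 := by
    have h := norm_sum_smul_projection_le F (fun i => (p i : H →L[ℂ] H)) hp hpq c hc1
    have h' : ((∑ i ∈ F, c i • p i : M.toStarSubalgebra) : H →L[ℂ] H) =
        ∑ i ∈ F, c i • (p i : H →L[ℂ] H) := by
      simp
    rw [← h'] at h
    exact h
  have h0 : 0 ≤ ∑ i ∈ F, ‖φ (p i)‖ := Finset.sum_nonneg fun i _ => norm_nonneg _
  calc ∑ i ∈ F, ‖φ (p i)‖ = ‖φ (∑ i ∈ F, c i • p i)‖ := by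
        rw [hφ, Complex.norm_real, Real.norm_of_nonneg h0]
    _ ≤ ‖φ‖ * ‖∑ i ∈ F, c i • p i‖ := φ.le_opNorm _
    _ ≤ ‖φ‖ := mul_le_of_le_one_right (norm_nonneg _) hT

theorem isSigmaFinite_of_isWLD (M : VonNeumannAlgebra H) (h : IsWLD ℂ M.Predual) :
    M.IsSigmaFinite := by
  intro P hP hpair
  obtain ⟨e, he⟩ := M.exists_equiv_dual_predual
  let p : ↥(P \ {0}) → M.toStarSubalgebra := fun q => ⟨q, (hP q q.2.1).1⟩
  have hc : Countable ↥(P \ {0}) := by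
    refine h.countable_of_sum_norm_le (fun q => e (p q)) (fun q hq => ?_) fun φ F => ?_
    · exact q.2.2 (congrArg Subtype.val ((map_eq_zero_iff e e.injective).1 hq))
    · simp only [he]
      rw [← (Predual.toDual M).norm_map φ]
      exact sum_norm_apply_projection_le M F p (fun q => (hP q q.2.1).2)
        (fun q r hqr => hpair q.2.1 r.2.1 fun h => hqr (Subtype.ext h)) _
  have hc' : (P \ {0}).Countable := hc
  exact (hc'.insert 0).mono fun q hq => by
    by_cases h0 : q = 0
    · exact Or.inl h0
    · exact Or.inr ⟨hq, h0⟩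

/-! ### Decomposition of the Hilbert space into cyclic subspaces of the commutant -/

/-- The closed linear span of the vectors `a ξ` with `a` in the commutant of `M` and `ξ ∈ F`. -/
noncomputable def cyclicSubspace (M : VonNeumannAlgebra H) (F : Set H) : Submodule ℂ H :=
  (Submodule.span ℂ {v | ∃ a ∈ M.commutant, ∃ ξ ∈ F, v = a ξ}).topologicalClosure

instance (M : VonNeumannAlgebra H) (F : Set H) :
    (M.cyclicSubspace F).HasOrthogonalProjection :=
  have : CompleteSpace (M.cyclicSubspace F) :=
    (Submodule.isClosed_topologicalClosure _).completeSpace_coe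
  inferInstance

theorem apply_mem_cyclicSubspace (M : VonNeumannAlgebra H) {F : Set H} {a : H →L[ℂ] H}
    (ha : a ∈ M.commutant) {ξ : H} (hξ : ξ ∈ F) : a ξ ∈ M.cyclicSubspace F :=
  Submodule.le_topologicalClosure _ (Submodule.subset_span ⟨a, ha, ξ, hξ, rfl⟩)

theorem mem_cyclicSubspace_self (M : VonNeumannAlgebra H) {F : Set H} {ξ : H} (hξ : ξ ∈ F) :
    ξ ∈ M.cyclicSubspace F :=
  M.apply_mem_cyclicSubspace (one_mem M.commutant) hξ

theorem cyclicSubspace_mono (M : VonNeumannAlgebra H) {F G : Set H} (h : F ⊆ G) :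
    M.cyclicSubspace F ≤ M.cyclicSubspace G :=
  Submodule.topologicalClosure_mono (Submodule.span_mono
    fun _ ⟨a, ha, ξ, hξ, hv⟩ => ⟨a, ha, ξ, h hξ, hv⟩)

theorem mem_orthogonal_cyclicSubspace (M : VonNeumannAlgebra H) {F : Set H} {η : H} :
    η ∈ (M.cyclicSubspace F)ᗮ ↔ ∀ a ∈ M.commutant, ∀ ξ ∈ F, ⟪a ξ, η⟫_ℂ = 0 := by
  rw [cyclicSubspace, Submodule.orthogonal_closure]
  refine ⟨fun h a ha ξ hξ => h _ (Submodule.subset_span ⟨a, ha, ξ, hξ, rfl⟩), fun h => ?_⟩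
  rw [Submodule.mem_orthogonal]
  intro u hu
  induction hu using Submodule.span_induction with
  | mem _ h' => obtain ⟨a, ha, ξ, hξ, rfl⟩ := h'; exact h a ha ξ hξ
  | zero => simp
  | add _ _ _ _ h1 h2 => rw [inner_add_left, h1, h2, add_zero]
  | smul c _ _ h1 => rw [inner_smul_left, h1, mul_zero]

/-- The projection onto a cyclic subspace of the commutant lies in `M`, since the subspace is
invariant under the commutant. -/
theorem starProjection_cyclicSubspace_mem (M : VonNeumannAlgebra H) (F : Set H) :
    (M.cyclicSubspace F).starProjection ∈ M := by
  rw [VonNeumannAlgebra.IsStarProjection.mem_iff isStarProjection_starProjection]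
  intro y hy
  rw [Submodule.range_starProjection, Module.End.mem_invtSubmodule]
  refine Submodule.topologicalClosure_minimal _ (Submodule.span_le.2 ?_)
    ((Submodule.isClosed_topologicalClosure _).preimage y.continuous)
  rintro _ ⟨a, ha, ξ, hξ, rfl⟩
  exact M.apply_mem_cyclicSubspace (mul_mem hy ha) hξ

/-- A generating set for the commutant, consisting of nonzero vectors with pairwise orthogonal
cyclic subspaces. -/
structure IsOrthogonalGenerating (M : VonNeumannAlgebra H) (Ξ : Set H) : Prop where
  ne_zero : ∀ ξ ∈ Ξ, ξ ≠ 0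
  orthogonal : ∀ ξ ∈ Ξ, ∀ ζ ∈ Ξ, ξ ≠ ζ → ∀ a ∈ M.commutant, ⟪a ξ, ζ⟫_ℂ = 0
  eq_top : M.cyclicSubspace Ξ = ⊤

theorem exists_isOrthogonalGenerating (M : VonNeumannAlgebra H) :
    ∃ Ξ : Set H, M.IsOrthogonalGenerating Ξ := by
  obtain ⟨Ξ, hΞ⟩ := zorn_subset
    {Ξ : Set H | (∀ ξ ∈ Ξ, ξ ≠ 0) ∧
      ∀ ξ ∈ Ξ, ∀ ζ ∈ Ξ, ξ ≠ ζ → ∀ a ∈ M.commutant, ⟪a ξ, ζ⟫_ℂ = 0} (by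
    intro c hc hchain
    refine ⟨⋃₀ c, ⟨?_, ?_⟩, fun s hs => Set.subset_sUnion_of_mem hs⟩
    · rintro ξ ⟨s, hs, hξ⟩
      exact (hc hs).1 ξ hξ
    · rintro ξ ⟨s, hs, hξ⟩ ζ ⟨t, ht, hζ⟩
      rcases hchain.total hs ht with h | h
      · exact (hc ht).2 ξ (h hξ) ζ hζ
      · exact (hc hs).2 ξ hξ ζ (h hζ))
  refine ⟨Ξ, hΞ.prop.1, hΞ.prop.2, ?_⟩
  rw [← Submodule.orthogonal_eq_bot_iff, Submodule.eq_bot_iff]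
  intro η hη
  by_contra hne
  have hη' := M.mem_orthogonal_cyclicSubspace.1 hη
  have hmem : η ∈ Ξ := by
    refine hΞ.le_of_ge (y := insert η Ξ) ⟨?_, ?_⟩ (Set.subset_insert _ _) (Set.mem_insert _ _)
    · rintro ξ (rfl | hξ)
      exacts [hne, hΞ.prop.1 ξ hξ]
    · rintro ξ (rfl | hξ) ζ (rfl | hζ) hξζ a ha
      · exact absurd rfl hξζ
      · have h := hη' (star a) (star_mem ha) ζ hζ
        rw [ContinuousLinearMap.star_eq_adjoint, ContinuousLinearMap.adjoint_inner_left] at h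
        rw [← inner_conj_symm, h, map_zero]
      · exact hη' a ha ξ hξ
      · exact hΞ.prop.2 ξ hξ ζ hζ hξζ a ha
  exact hne (inner_self_eq_zero.1 (hη' 1 (one_mem _) η hmem))

namespace IsOrthogonalGenerating

variable {M : VonNeumannAlgebra H} {Ξ : Set H}

theorem starProjection_apply_eq_zero (hΞ : M.IsOrthogonalGenerating Ξ) {F : Set H} (hF : F ⊆ Ξ)
    {ξ : H} (hξ : ξ ∈ Ξ) (hξF : ξ ∉ F) : (M.cyclicSubspace F).starProjection ξ = 0 := by
  rw [Submodule.starProjection_apply_eq_zero_iff, mem_orthogonal_cyclicSubspace]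
  intro a ha ζ hζ
  exact hΞ.orthogonal ζ (hF hζ) ξ hξ (fun h => hξF (h ▸ hζ)) a ha

/-- The projections onto the cyclic subspaces of finite subsets converge strongly to `1`. -/
theorem tendsto_starProjection (hΞ : M.IsOrthogonalGenerating Ξ) (x : H) :
    Tendsto (fun F : Finset Ξ => (M.cyclicSubspace ((↑) '' (F : Set Ξ))).starProjection x)
      atTop (𝓝 x) := by
  refine Submodule.starProjection_tendsto_self _
    (fun F G h => M.cyclicSubspace_mono (Set.image_mono (by exact_mod_cast h))) x ?_
  rw [← hΞ.eq_top]
  refine Submodule.topologicalClosure_mono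
    (s := Submodule.span ℂ {v | ∃ a ∈ M.commutant, ∃ ξ ∈ Ξ, v = a ξ}) (Submodule.span_le.2 ?_)
  rintro _ ⟨a, ha, ξ, hξ, rfl⟩
  have h := le_iSup (fun F : Finset Ξ => M.cyclicSubspace ((↑) '' (F : Set Ξ))) {⟨ξ, hξ⟩}
  exact h (M.apply_mem_cyclicSubspace ha (by simp))

/-- The cyclic projections of a generating set are pairwise orthogonal and nonzero, so that there
are only countably many of them if `M` is `σ`-finite. -/
theorem countable (hΞ : M.IsOrthogonalGenerating Ξ) (hM : M.IsSigmaFinite) : Ξ.Countable := by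
  set p : H → H →L[ℂ] H := fun ξ => (M.cyclicSubspace {ξ}).starProjection with hp
  have hself : ∀ ξ, p ξ ξ = ξ := fun ξ =>
    Submodule.starProjection_eq_self_iff.2 (M.mem_cyclicSubspace_self rfl)
  have hinj : Set.InjOn p Ξ := by
    intro ξ hξ ζ hζ h
    by_contra hne
    have h0 : p ζ ξ = 0 := hΞ.starProjection_apply_eq_zero (by simpa using hζ) hξ (by simpa using hne)
    rw [← h, hself] at h0
    exact hΞ.ne_zero ξ hξ h0
  refine Set.countable_of_injective_of_countable_image hinj (hM _ ?_ ?_)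
  · rintro _ ⟨ξ, -, rfl⟩
    exact ⟨M.starProjection_cyclicSubspace_mem _, isStarProjection_starProjection⟩
  · rintro _ ⟨ξ, hξ, rfl⟩ _ ⟨ζ, hζ, rfl⟩ hne
    have hne' : ξ ≠ ζ := fun h => hne (h ▸ rfl)
    ext x
    rw [mul_apply_eq_comp, zero_apply,
      Submodule.starProjection_apply_eq_zero_iff, mem_orthogonal_cyclicSubspace]
    rintro a ha ξ' hξ'
    obtain rfl : ξ' = ξ := hξ'
    have hort : a ξ' ∈ (M.cyclicSubspace {ζ})ᗮ := by
      rw [mem_orthogonal_cyclicSubspace]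
      rintro b hb ζ' hζ'
      obtain rfl : ζ' = ζ := hζ'
      have h := hΞ.orthogonal _ hζ _ hξ hne'.symm (star a * b) (mul_mem (star_mem ha) hb)
      rwa [mul_apply_eq_comp, ContinuousLinearMap.star_eq_adjoint,
        ContinuousLinearMap.adjoint_inner_left] at h
    exact Submodule.inner_left_of_mem_orthogonal (Submodule.starProjection_apply_mem _ _) hort

/-! ### Functionals on the predual through a generating set -/

/-- `x ∈ M` is determined by the values `x* ξ`, `ξ ∈ Ξ`, because `x*` commutes with the commutant;
and these values are determined by their inner products with an orthonormal basis. -/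
theorem isLinearlyDense_vec (hΞ : M.IsOrthogonalGenerating Ξ) {w : Set H}
    (b : HilbertBasis w ℂ H) {c : w × Ξ → ℂ} (hc : ∀ i, c i ≠ 0) :
    IsLinearlyDense (𝕜 := ℂ)
      (Set.range fun i : w × Ξ => c i • Predual.vec M (b i.1) i.2) := by
  obtain ⟨e, he⟩ := M.exists_equiv_dual_predual
  refine isLinearlyDense_of_forall_dual fun f hf => ?_
  obtain ⟨x, rfl⟩ := e.surjective f
  set y : H →L[ℂ] H := star (x : H →L[ℂ] H) with hy
  have hyM : y ∈ M := star_mem x.2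
  have h1 : ∀ ξ ∈ Ξ, y ξ = 0 := fun ξ hξ => by
    refine b.repr.injective (lp.ext (funext fun i => ?_))
    have h := hf _ ⟨(i, ⟨ξ, hξ⟩), rfl⟩
    rw [map_smul, smul_eq_mul, mul_eq_zero, or_iff_right (hc _), he, Predual.toDual_vec,
      ← ContinuousLinearMap.adjoint_inner_left, ← inner_conj_symm, map_eq_zero] at h
    rw [b.repr_apply_apply, map_zero]
    exact h
  have h2 : y = 0 := by
    refine ContinuousLinearMap.ext fun v => ?_
    have hv : v ∈ M.cyclicSubspace Ξ := hΞ.eq_top ▸ Submodule.mem_top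
    refine Submodule.topologicalClosure_minimal (t := y.ker) _ (Submodule.span_le.2 ?_)
      y.isClosed_ker hv
    rintro _ ⟨a, ha, ξ, hξ, rfl⟩
    change y (a ξ) = 0
    rw [← mul_apply_eq_comp, mem_commutant_iff.1 ha y hyM, mul_apply_eq_comp, h1 ξ hξ, map_zero]
  have h3 : x = 0 := Subtype.ext (star_eq_zero.1 h2)
  rw [h3, map_zero]

/-- `⟪ξ, x e⟫ = ⟪x* ξ, e⟫` vanishes unless `x* ξ ≠ 0`, and for fixed `ξ` it is nonzero for only
countably many basis vectors `e`. -/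
theorem countable_support_vec {w : Set H} (b : HilbertBasis w ℂ H) (x : M.toStarSubalgebra)
    (hx : {ξ ∈ Ξ | star (x : H →L[ℂ] H) ξ ≠ 0}.Countable) :
    {φ ∈ Set.range fun i : w × Ξ => Predual.vec M (b i.1) i.2 |
      Predual.toDual M φ x ≠ 0}.Countable := by
  have hsub : {φ ∈ Set.range fun i : w × Ξ => Predual.vec M (b i.1) i.2 |
      Predual.toDual M φ x ≠ 0} ⊆ ⋃ ξ ∈ {ξ ∈ Ξ | star (x : H →L[ℂ] H) ξ ≠ 0},
        (fun i => Predual.vec M (b i) ξ) '' {i | ⟪b i, star (x : H →L[ℂ] H) ξ⟫_ℂ ≠ 0} := by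
    rintro _ ⟨⟨⟨i, ξ⟩, rfl⟩, hne⟩
    have hne' : ⟪b i, star (x : H →L[ℂ] H) ξ⟫_ℂ ≠ 0 := fun h => hne <| by
      rw [Predual.toDual_vec, ← ContinuousLinearMap.adjoint_inner_left, ← inner_conj_symm]
      exact (map_eq_zero _).2 h
    simp only [Set.mem_iUnion]
    exact ⟨ξ, ⟨ξ.2, fun h => hne' (by rw [h, inner_zero_right])⟩, i, hne', rfl⟩
  refine (hx.biUnion fun ξ _ => Set.Countable.image ?_ _).mono hsub
  refine (b.orthonormal.inner_products_summable (star (x : H →L[ℂ] H) ξ)).countable_support.mono ?_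
  intro i hi
  simpa using hi

theorem isOnePlichko (hΞ : M.IsOrthogonalGenerating Ξ) : IsOnePlichko ℂ M.Predual := by
  obtain ⟨e, he⟩ := M.exists_equiv_dual_predual
  obtain ⟨w, b, -⟩ := exists_hilbertBasis ℂ H
  set S := Set.range fun i : w × Ξ => Predual.vec M (b i.1) i.2 with hS
  have hdense : IsLinearlyDense (𝕜 := ℂ) S := by
    simpa using! hΞ.isLinearlyDense_vec b (c := fun _ => 1) fun _ => one_ne_zero
  refine ⟨countableSupport ℂ S, fun φ => ⟨?_, fun r hr => ?_⟩, S, hdense, fun f => Iff.rfl⟩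
  · rintro _ ⟨f, -, hf, rfl⟩
    exact (f.le_opNorm φ).trans (mul_le_of_le_one_left (norm_nonneg _) hf)
  have hr0 : 0 ≤ r := hr ⟨0, Submodule.zero_mem _, by simp, by simp⟩
  rw [← (Predual.toDual M).norm_map]
  refine ContinuousLinearMap.opNorm_le_bound _ hr0 fun x => ?_
  rw [← he]
  set P : Finset Ξ → H →L[ℂ] H :=
    fun F => (M.cyclicSubspace ((↑) '' (F : Set Ξ))).starProjection with hP
  have hPM : ∀ F, P F ∈ M := fun F => M.starProjection_cyclicSubspace_mem _
  set z : Finset Ξ → M.toStarSubalgebra := fun F => ⟨P F, hPM F⟩ * x with hz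
  have hzx : ∀ F, ‖z F‖ ≤ ‖x‖ := fun F =>
    (norm_mul_le _ _).trans (mul_le_of_le_one_left (norm_nonneg _)
      (Submodule.starProjection_norm_le _))
  -- `(P F * x)* ξ = x* (P F ξ)` vanishes for `ξ` outside the finite set `F`.
  have hzD : ∀ F, e (z F) ∈ countableSupport ℂ S := fun F => by
    rw [mem_countableSupport]
    simp only [he]
    refine countable_support_vec b (z F) ((F.countable_toSet.image Subtype.val).mono ?_)
    rintro ξ ⟨hξ, hne⟩
    by_contra hF
    have hsa : star (P F) = P F := (isStarProjection_starProjection (𝕜 := ℂ)).isSelfAdjoint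
    have h0 : P F ξ = 0 := hΞ.starProjection_apply_eq_zero (by simp) hξ hF
    refine hne ?_
    change star (P F * (x : H →L[ℂ] H)) ξ = 0
    rw [star_mul, hsa, mul_apply_eq_comp, h0, map_zero]
  have hlim : Tendsto (fun F => e (z F) φ) atTop (𝓝 (e x φ)) := by
    refine IsLinearlyDense.tendsto_apply (Predual.dense_span_vec M) (fun F => e (z F)) (e x) ‖x‖₊
      (fun F => ?_) ?_ φ
    · have h : ‖e (z F)‖ ≤ ‖x‖ := by rw [e.norm_map]; exact hzx F
      exact h
    · rintro _ ⟨ξ, η, rfl⟩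
      simp only [he, Predual.toDual_vec]
      exact tendsto_const_nhds.inner (hΞ.tendsto_starProjection ((x : H →L[ℂ] H) ξ))
  refine le_of_tendsto hlim.norm (Eventually.of_forall fun F => ?_)
  rcases eq_or_ne ‖x‖ 0 with h0 | h0
  · have h1 : z F = 0 := norm_le_zero_iff.1 (h0 ▸ hzx F)
    rw [h1, map_zero, h0]
    simp
  have hpos : 0 < ‖x‖ := lt_of_le_of_ne (norm_nonneg x) h0.symm
  have h1 : ‖((‖x‖⁻¹ : ℝ) : ℂ) • e (z F)‖ ≤ 1 := by
    rw [norm_smul, e.norm_map, Complex.norm_real, norm_inv, norm_norm, inv_mul_le_iff₀ hpos,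
      mul_one]
    exact hzx F
  have h2 := hr ⟨_, Submodule.smul_mem _ _ (hzD F), h1, rfl⟩
  rw [smul_apply, norm_smul, Complex.norm_real, norm_inv, norm_norm,
    inv_mul_le_iff₀ hpos, mul_comm] at h2
  exact h2

theorem isWLD (hΞ : M.IsOrthogonalGenerating Ξ) (hc : Ξ.Countable) : IsWLD ℂ M.Predual := by
  obtain ⟨e, he⟩ := M.exists_equiv_dual_predual
  obtain ⟨w, b, -⟩ := exists_hilbertBasis ℂ H
  refine ⟨Set.range fun i : w × Ξ => Predual.vec M (b i.1) i.2, ?_, fun f => ?_⟩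
  · simpa using! hΞ.isLinearlyDense_vec b (c := fun _ => 1) fun _ => one_ne_zero
  · obtain ⟨x, rfl⟩ := e.surjective f
    simp only [Submodule.mem_top, true_iff, he]
    exact countable_support_vec b x (hc.mono fun ξ hξ => hξ.1)

theorem isWCG (hΞ : M.IsOrthogonalGenerating Ξ) (hc : Ξ.Countable) : IsWCG ℂ M.Predual := by
  obtain ⟨e, he⟩ := M.exists_equiv_dual_predual
  obtain ⟨w, b, -⟩ := exists_hilbertBasis ℂ H
  have := hc.to_subtype
  let _ : Encodable Ξ := Encodable.ofCountable Ξ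
  -- Weights making `∑ (c ξ * ‖ξ‖) ^ 2` finite.
  set c : Ξ → ℝ := fun ξ => (1 / 2) ^ Encodable.encode ξ / ‖(ξ : H)‖ with hcdef
  have hξ0 : ∀ ξ : Ξ, 0 < ‖(ξ : H)‖ := fun ξ => norm_pos_iff.2 (hΞ.ne_zero ξ ξ.2)
  have hc0 : ∀ ξ, 0 < c ξ := fun ξ => div_pos (by positivity) (hξ0 ξ)
  refine isWCG_of_tendsto_cofinite _ (hΞ.isLinearlyDense_vec b (c := fun i => (c i.2 : ℂ))
    fun i => by simpa using (hc0 i.2).ne') fun f => ?_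
  obtain ⟨x, rfl⟩ := e.surjective f
  set y : H →L[ℂ] H := star (x : H →L[ℂ] H) with hy
  have hval : ∀ i : w × Ξ, ‖e x ((c i.2 : ℂ) • Predual.vec M (b i.1) i.2)‖ ^ 2 =
      c i.2 ^ 2 * ‖⟪b i.1, y i.2⟫_ℂ‖ ^ 2 := fun i => by
    rw [map_smul, he, Predual.toDual_vec, ← ContinuousLinearMap.adjoint_inner_left,
      ← ContinuousLinearMap.star_eq_adjoint, norm_smul, mul_pow,
      Complex.norm_of_nonneg (hc0 i.2).le, norm_inner_symm]
  -- By Bessel's inequality the values of `x` on the family are square summable.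
  have hB : ∀ ξ : Ξ, Summable fun i => ‖⟪b i, y ξ⟫_ℂ‖ ^ 2 := fun ξ =>
    b.orthonormal.inner_products_summable (y ξ)
  have hsum' : Summable fun i : Ξ × w => c i.1 ^ 2 * ‖⟪b i.2, y i.1⟫_ℂ‖ ^ 2 := by
    refine (summable_prod_of_nonneg fun i => ?_).2 ⟨fun ξ => ?_, ?_⟩
    · exact mul_nonneg (sq_nonneg _) (sq_nonneg _)
    · exact (hB ξ).mul_left (c ξ ^ 2)
    · refine Summable.of_nonneg_of_le (fun ξ => tsum_nonneg fun i =>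
        mul_nonneg (sq_nonneg _) (sq_nonneg _)) (fun ξ => ?_)
        ((summable_geometric_two_encode (ι := Ξ)).mul_right (‖y‖ ^ 2))
      change ∑' i, c ξ ^ 2 * ‖⟪b i, y ξ⟫_ℂ‖ ^ 2 ≤ _
      rw [tsum_mul_left]
      have h1 : ∑' i, ‖⟪b i, y ξ⟫_ℂ‖ ^ 2 ≤ (‖y‖ * ‖(ξ : H)‖) ^ 2 :=
        (b.orthonormal.tsum_inner_products_le (y ξ)).trans (by gcongr; exact y.le_opNorm _)
      have h2 : c ξ * ‖(ξ : H)‖ = (1 / 2) ^ Encodable.encode ξ :=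
        div_mul_cancel₀ _ (hξ0 ξ).ne'
      calc c ξ ^ 2 * ∑' i, ‖⟪b i, y ξ⟫_ℂ‖ ^ 2 ≤ c ξ ^ 2 * (‖y‖ * ‖(ξ : H)‖) ^ 2 := by gcongr
        _ = ((1 / 2) ^ Encodable.encode ξ) ^ 2 * ‖y‖ ^ 2 := by rw [← h2]; ring
        _ ≤ (1 / 2) ^ Encodable.encode ξ * ‖y‖ ^ 2 := by
          gcongr
          exact pow_le_of_le_one (by positivity) (pow_le_one₀ (by norm_num) (by norm_num))
            two_ne_zero
  have hsum : Summable fun i : w × Ξ => c i.2 ^ 2 * ‖⟪b i.1, y i.2⟫_ℂ‖ ^ 2 := hsum'.prod_symm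
  have ht := hsum.tendsto_cofinite_zero
  simp only [← hval] at ht
  refine tendsto_zero_iff_norm_tendsto_zero.2 ?_
  have hs := (Real.continuous_sqrt.tendsto 0).comp ht
  simpa only [Function.comp_def, Real.sqrt_sq (norm_nonneg _), Real.sqrt_zero] using hs

end IsOrthogonalGenerating

end VonNeumannAlgebra

theorem theorem1 {H : Type*} [NormedAddCommGroup H] [InnerProductSpace ℂ H] [CompleteSpace H]
    (M : VonNeumannAlgebra H) :
    IsOnePlichko ℂ M.Predual ∧
      (IsWLD ℂ M.Predual ↔ M.IsSigmaFinite) ∧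
      (M.IsSigmaFinite → IsWCG ℂ M.Predual) := by
  obtain ⟨Ξ, hΞ⟩ := M.exists_isOrthogonalGenerating
  exact ⟨hΞ.isOnePlichko,
    ⟨M.isSigmaFinite_of_isWLD, fun hM => hΞ.isWLD (hΞ.countable hM)⟩,
    fun hM => hΞ.isWCG (hΞ.countable hM)⟩
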